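/- **Theorem 4.1.** Let $\mathcal M$ be the universe of sets with atoms (satisfying choice) over a set $U$ of atoms indexed by the rational numbers, $U$ being ordered like $\mathbb Q$. Let $G$ be the group of order-preserving permutations of $U$, acting on $\mathcal M$ in the natural way, and let $\mathcal F$ be the normal filter of subgroups of $G$ generated by the pointwise stabilizers of finite subsets of $U$. Let $\mathcal N$ (Mostowski's ordered model) be the class of all $x\in\mathcal M$ that are hereditarily symmetric, i.e. $x$, its elements, their elements, and so on, all have their stabilizer in $\mathcal F$. The set $U$ and its order $\le$ belong to $\mathcal N$, and the following holds in $\mathcal N$. 1. $(U,\le)$ is embedding-rigid and epimorphism-rigid: the only injective order-preserving map $U\to U$ is the identity, and the only surjective order-preserving map $U\to U$ is the identity. (Order-preserving means $x\le y\Rightarrow f(x)\le f(y)$.) 2. Let $f$ be any endomorphism of $(U,\le)$, i.e. any order-preserving map $U\to U$. Then $f$ is locally identity-constant: the set $C_f\cup I_f$ is dense in $U$, where $$C_f=\{x\in U:\exists a,b\in U\ (a<x<b \text{ and } f \text{ is constant on } [a,x] \text{ or on } [x,b])\},\qquad I_f=\{x\in U: f(x)=x\}.$$ Moreover $f$ has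 only finitely many intervals of constancy: the maximal non-trivial intervals on which $f$ is constant form a finite set, and each non-trivial interval on which $f$ is constant is contained in one of them. (A non-trivial interval is a convex subset of $U$ with at least two points.) -/

import Mathlib

universe u

namespace Mostowski

/-! ### The universe of sets over atoms indexed by the rationals -/

/-- Codes for sets with atoms: a code is an atom `q` with `q` rational, or a family of codes
indexed by a type. -/
inductive Pre : Type (u + 1)
  | atom (q : ℚ) : Pre
  | mk (α : Type u) (A : α → Pre) : Pre

namespace Pre

/-- Two codes denote the same object: extensional equality for sets, equality of indices for
atoms. An atom never equals a set (in particular, atoms differ from the empty set). -/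
def Equiv : Pre.{u} → Pre.{u} → Prop
  | atom p, atom q => p = q
  | mk _ A, mk _ B => (∀ a, ∃ b, Equiv (A a) (B b)) ∧ ∀ b, ∃ a, Equiv (A a) (B b)
  | atom _, mk _ _ => False
  | mk _ _, atom _ => False

theorem Equiv.refl : ∀ x : Pre.{u}, Equiv x x
  | atom _ => rfl
  | mk _ A => ⟨fun a => ⟨a, Equiv.refl (A a)⟩, fun a => ⟨a, Equiv.refl (A a)⟩⟩

theorem Equiv.symm : ∀ {x y : Pre.{u}}, Equiv x y → Equiv y x
  | atom _, atom _, h => Eq.symm h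
  | mk _ _, mk _ _, h =>
    ⟨fun b => let ⟨a, ha⟩ := h.2 b; ⟨a, ha.symm⟩, fun a => let ⟨b, hb⟩ := h.1 a; ⟨b, hb.symm⟩⟩

theorem Equiv.trans : ∀ {x y z : Pre.{u}}, Equiv x y → Equiv y z → Equiv x z
  | atom _, atom _, atom _, h, k => Eq.trans h k
  | mk _ _, mk _ _, mk _ _, h, k =>
    ⟨fun a => let ⟨b, hb⟩ := h.1 a; let ⟨c, hc⟩ := k.1 b; ⟨c, hb.trans hc⟩,
     fun c => let ⟨b, hb⟩ := k.2 c; let ⟨a, ha⟩ := h.2 b; ⟨a, ha.trans hb⟩⟩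

instance setoid : Setoid Pre.{u} :=
  ⟨Equiv, Equiv.refl, Equiv.symm, Equiv.trans⟩

/-- Membership of codes. Atoms have no elements. -/
def Mem (x : Pre.{u}) : Pre.{u} → Prop
  | atom _ => False
  | mk _ A => ∃ a, Equiv x (A a)

theorem Mem.congr {x x' y y' : Pre.{u}} (hx : Equiv x x') (hy : Equiv y y') :
    Mem x y → Mem x' y' := by
  cases y <;> cases y' <;> simp only [Mem, Equiv] at *
  · exact id
  · rintro ⟨a, ha⟩
    obtain ⟨b, hb⟩ := hy.1 a
    exact ⟨b, hx.symm.trans (ha.trans hb)⟩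

/-- An order automorphism `g` of the atoms acts on all codes by
`g q = g(q)` on atoms and `g x = {g y : y ∈ x}` on sets. -/
def act (g : ℚ ≃o ℚ) : Pre.{u} → Pre.{u}
  | atom q => atom (g q)
  | mk α A => mk α fun a => act g (A a)

theorem act_congr (g : ℚ ≃o ℚ) : ∀ {x y : Pre.{u}}, Equiv x y → Equiv (act g x) (act g y)
  | atom _, atom _, h => congrArg g h
  | mk _ _, mk _ _, h =>
    ⟨fun a => let ⟨b, hb⟩ := h.1 a; ⟨b, act_congr g hb⟩,
     fun b => let ⟨a, ha⟩ := h.2 b; ⟨a, act_congr g ha⟩⟩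

theorem act_one : ∀ x : Pre.{u}, act 1 x = x
  | atom _ => rfl
  | mk α A => congrArg (mk α) (funext fun a => act_one (A a))

theorem act_mul (g h : ℚ ≃o ℚ) : ∀ x : Pre.{u}, act (g * h) x = act g (act h x)
  | atom _ => rfl
  | mk α A => congrArg (mk α) (funext fun a => act_mul g h (A a))

end Pre

/-- The universe `𝓜` of sets over the set of atoms `ℚ` (the choice-satisfying universe with
atoms in which the permutation model is formed). -/
def ZFA : Type (u + 1) := Quotient Pre.setoid.{u}

namespace ZFA

/-- The object denoted by a code. -/
def mk (x : Pre.{u}) : ZFA.{u} := Quotient.mk _ x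

/-- The atom with index `q`. -/
def atom (q : ℚ) : ZFA.{u} := mk (Pre.atom q)

instance : Membership ZFA.{u} ZFA.{u} where
  mem y x := Quotient.liftOn₂ x y Pre.Mem fun _ _ _ _ hx hy =>
    propext ⟨Pre.Mem.congr hx hy, Pre.Mem.congr hx.symm hy.symm⟩

/-- The action of the group of order automorphisms of the atoms on the universe. -/
instance : MulAction (ℚ ≃o ℚ) ZFA.{u} where
  smul g := Quotient.map (Pre.act g) fun _ _ h => Pre.act_congr g h
  one_smul x := Quotient.inductionOn x fun x => congrArg (Quotient.mk _) (Pre.act_one x)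
  mul_smul g h x :=
    Quotient.inductionOn x fun x => congrArg (Quotient.mk _) (Pre.act_mul g h x)

/-- A chosen code of `x`. -/
noncomputable def rep (x : ZFA.{u}) : Pre.{u} := Quotient.out x

theorem mk_rep (x : ZFA.{u}) : mk x.rep = x := Quotient.out_eq x

/-- The set `{A a : a ∈ α}`. -/
noncomputable def ofFamily {α : Type u} (A : α → ZFA.{u}) : ZFA.{u} :=
  mk (Pre.mk α fun a => (A a).rep)

theorem mem_ofFamily {α : Type u} {A : α → ZFA.{u}} {x : ZFA.{u}} :
    x ∈ ofFamily A ↔ ∃ a, x = A a := by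
  refine Quotient.inductionOn x fun x => ?_
  exact exists_congr fun a => ⟨fun h => (Quotient.sound h).trans (mk_rep (A a)),
    fun h => Quotient.exact (h.trans (mk_rep (A a)).symm)⟩

theorem not_mem_atom (x : ZFA.{u}) (q : ℚ) : x ∉ atom.{u} q :=
  Quotient.inductionOn x fun _ h => h

theorem ofFamily_congr {α β : Type u} {A : α → ZFA.{u}} {B : β → ZFA.{u}}
    (h : ∀ a, ∃ b, A a = B b) (k : ∀ b, ∃ a, A a = B b) : ofFamily A = ofFamily B :=
  Quotient.sound
    ⟨fun a => (h a).imp fun b hb => by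
      show Pre.Equiv (A a).rep (B b).rep
      rw [hb]
      exact Pre.Equiv.refl _,
     fun b => (k b).imp fun a ha => by
      show Pre.Equiv (A a).rep (B b).rep
      rw [ha]
      exact Pre.Equiv.refl _⟩

theorem smul_atom (g : ℚ ≃o ℚ) (q : ℚ) : g • atom.{u} q = atom (g q) := rfl

theorem smul_ofFamily (g : ℚ ≃o ℚ) {α : Type u} (A : α → ZFA.{u}) :
    g • ofFamily A = ofFamily fun a => g • A a := by
  have key : ∀ a, Pre.Equiv (Pre.act g (A a).rep) (g • A a).rep := fun a => by
    have h : g • mk (A a).rep = mk (g • A a).rep := by rw [mk_rep, mk_rep]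
    exact Quotient.exact h
  exact Quotient.sound ⟨fun a => ⟨a, key a⟩, fun a => ⟨a, key a⟩⟩

/-- The unordered pair `{x, y}`. -/
noncomputable def pair (x y : ZFA.{u}) : ZFA.{u} :=
  ofFamily fun b : ULift.{u} Bool => cond b.down x y

/-- Kuratowski's ordered pair `{{x}, {x, y}}`. -/
noncomputable def opair (x y : ZFA.{u}) : ZFA.{u} := pair (pair x x) (pair x y)

theorem smul_pair (g : ℚ ≃o ℚ) (x y : ZFA.{u}) : g • pair x y = pair (g • x) (g • y) := by
  unfold pair
  rw [smul_ofFamily]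
  congr 1
  funext b
  rcases b with ⟨_ | _⟩ <;> rfl

theorem smul_opair (g : ℚ ≃o ℚ) (x y : ZFA.{u}) : g • opair x y = opair (g • x) (g • y) := by
  simp only [opair, smul_pair]

end ZFA

/-! ### The permutation model -/

/-- The normal filter of subgroups of the group of order automorphisms of the atoms generated by
the pointwise stabilizers of finite sets of atoms: `H` belongs to it iff `H` contains the
pointwise stabilizer of some finite set of atoms. -/
def finiteSupportFilter : Set (Subgroup (ℚ ≃o ℚ)) :=
  {H | ∃ A : Finset ℚ, ∀ g : ℚ ≃o ℚ, (∀ a ∈ A, g a = a) → g ∈ H}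

/-- `x` is symmetric: its stabilizer belongs to the normal filter. -/
def Symmetric (x : ZFA.{u}) : Prop :=
  MulAction.stabilizer (ℚ ≃o ℚ) x ∈ finiteSupportFilter

/-- `x` is hereditarily symmetric: `x`, its elements, their elements, and so on, are all
symmetric. -/
inductive HereditarilySymmetric : ZFA.{u} → Prop
  | intro (x : ZFA.{u}) : Symmetric x → (∀ y, y ∈ x → HereditarilySymmetric y) →
      HereditarilySymmetric x

/-- Mostowski's ordered permutation model `𝓝`. -/
def Model : Type (u + 1) := {x : ZFA.{u} // HereditarilySymmetric x}

theorem hs_atom (q : ℚ) : HereditarilySymmetric (ZFA.atom.{u} q) := by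
  refine .intro _ ⟨{q}, fun g hg => ?_⟩ fun y hy => (ZFA.not_mem_atom y q hy).elim
  rw [MulAction.mem_stabilizer_iff, ZFA.smul_atom, hg q (Finset.mem_singleton_self q)]

theorem HereditarilySymmetric.symmetric {x : ZFA.{u}} (h : HereditarilySymmetric x) :
    Symmetric x := by
  cases h; assumption

theorem hs_pair {x y : ZFA.{u}} (hx : HereditarilySymmetric x) (hy : HereditarilySymmetric y) :
    HereditarilySymmetric (ZFA.pair x y) := by
  obtain ⟨A, hA⟩ := hx.symmetric
  obtain ⟨B, hB⟩ := hy.symmetric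
  refine .intro _ ⟨A ∪ B, fun g hg => ?_⟩ fun z hz => ?_
  · have h1 := hA g fun a ha => hg a (Finset.mem_union_left _ ha)
    have h2 := hB g fun a ha => hg a (Finset.mem_union_right _ ha)
    rw [MulAction.mem_stabilizer_iff] at *
    rw [ZFA.smul_pair, h1, h2]
  · obtain ⟨⟨b⟩, rfl⟩ := ZFA.mem_ofFamily.1 hz
    cases b
    · exact hy
    · exact hx

theorem hs_atoms : HereditarilySymmetric
    (ZFA.ofFamily.{u} fun q : ULift.{u} ℚ => ZFA.atom q.down) := by
  refine .intro _ ⟨∅, fun g _ => ?_⟩ fun z hz => ?_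
  · rw [MulAction.mem_stabilizer_iff, ZFA.smul_ofFamily]
    refine ZFA.ofFamily_congr (fun a => ⟨⟨g a.down⟩, rfl⟩) fun b => ⟨⟨g.symm b.down⟩, ?_⟩
    simp [ZFA.smul_atom]
  · obtain ⟨q, rfl⟩ := ZFA.mem_ofFamily.1 hz
    exact hs_atom _

theorem hs_order : HereditarilySymmetric
    (ZFA.ofFamily.{u} fun p : ULift.{u} {p : ℚ × ℚ // p.1 ≤ p.2} =>
      ZFA.opair (ZFA.atom p.down.1.1) (ZFA.atom p.down.1.2)) := by
  refine .intro _ ⟨∅, fun g _ => ?_⟩ fun z hz => ?_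
  · rw [MulAction.mem_stabilizer_iff, ZFA.smul_ofFamily]
    refine ZFA.ofFamily_congr
      (fun a => ⟨⟨⟨(g a.down.1.1, g a.down.1.2), g.monotone a.down.2⟩⟩, ?_⟩)
      fun b => ⟨⟨⟨(g.symm b.down.1.1, g.symm b.down.1.2), g.symm.monotone b.down.2⟩⟩, ?_⟩
    · simp [ZFA.smul_opair, ZFA.smul_atom]
    · simp [ZFA.smul_opair, ZFA.smul_atom]
  · obtain ⟨p, rfl⟩ := ZFA.mem_ofFamily.1 hz
    exact hs_pair (hs_pair (hs_atom _) (hs_atom _)) (hs_pair (hs_atom _) (hs_atom _))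

namespace Model

instance : Membership Model.{u} Model.{u} where
  mem y x := x.1 ∈ y.1

/-- The atom with index `q`, as an object of the model. -/
def atom (q : ℚ) : Model.{u} := ⟨ZFA.atom q, hs_atom q⟩

/-- The set `U` of all atoms, as an object of the model. -/
noncomputable def U : Model.{u} :=
  ⟨ZFA.ofFamily fun q : ULift.{u} ℚ => ZFA.atom q.down, hs_atoms⟩

/-- The order of `U`, as an object of the model: the set of all ordered pairs of atoms
`(p, q)` with `p ≤ q`. -/
noncomputable def leU : Model.{u} :=
  ⟨ZFA.ofFamily fun p : ULift.{u} {p : ℚ × ℚ // p.1 ≤ p.2} =>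
      ZFA.opair (ZFA.atom p.down.1.1) (ZFA.atom p.down.1.2), hs_order⟩

/-! ### Notions of set theory, interpreted in the model

All variables below range over objects of the model: these are the usual set-theoretic notions
relativised to it. -/

/-- `x` is a set, that is, not an atom. -/
def IsSet (x : Model.{u}) : Prop := ∀ q : ℚ, x ≠ atom q

/-- `p = {x, y}`. -/
def IsPair (p x y : Model.{u}) : Prop := ∀ z : Model.{u}, z ∈ p ↔ z = x ∨ z = y

/-- `p = (x, y)`, Kuratowski's ordered pair `{{x}, {x, y}}`. -/
def IsOrderedPair (p x y : Model.{u}) : Prop :=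
  ∀ z : Model.{u}, z ∈ p ↔ IsPair z x x ∨ IsPair z x y

/-- `(x, y) ∈ r`; for a function `r` this says `r(x) = y`, for an order `r` that `x ≤ y`. -/
def Rel (r x y : Model.{u}) : Prop := ∃ p : Model.{u}, p ∈ r ∧ IsOrderedPair p x y

/-- `f` is a function from `X` to `Y`. -/
def IsFunction (f X Y : Model.{u}) : Prop :=
  IsSet f ∧
  (∀ p : Model.{u}, p ∈ f → ∃ x y : Model.{u}, x ∈ X ∧ y ∈ Y ∧ IsOrderedPair p x y) ∧
  ∀ x : Model.{u}, x ∈ X → ∃! y : Model.{u}, Rel f x y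

/-- The function `f` is surjective onto `Y`. -/
def IsSurjective (f Y : Model.{u}) : Prop :=
  ∀ y : Model.{u}, y ∈ Y → ∃ x : Model.{u}, Rel f x y

/-- The function `f` is injective. -/
def IsInjective (f : Model.{u}) : Prop :=
  ∀ x x' y : Model.{u}, Rel f x y → Rel f x' y → x = x'

/-- `e` is the empty set. -/
def IsEmptySet (e : Model.{u}) : Prop := IsSet e ∧ ∀ z : Model.{u}, z ∉ e

/-- `s = x ∪ {x}`. -/
def IsSuccessor (s x : Model.{u}) : Prop := ∀ z : Model.{u}, z ∈ s ↔ z ∈ x ∨ z = x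

/-- `I` contains the empty set and is closed under successors. -/
def IsInductiveSet (I : Model.{u}) : Prop :=
  (∃ e : Model.{u}, e ∈ I ∧ IsEmptySet e) ∧
  ∀ x : Model.{u}, x ∈ I → ∃ s : Model.{u}, s ∈ I ∧ IsSuccessor s x

/-- `n` is a (von Neumann) natural number: it lies in every inductive set. -/
def IsNatural (n : Model.{u}) : Prop := ∀ I : Model.{u}, IsInductiveSet I → n ∈ I

/-- `S` is finite: some function maps a natural number bijectively onto `S`. -/
def IsFinite (S : Model.{u}) : Prop :=
  IsSet S ∧ ∃ n h : Model.{u},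
    IsNatural n ∧ IsFunction h n S ∧ IsInjective h ∧ IsSurjective h S

/-! ### Chains and their endomorphisms, interpreted in the model

`X` is the underlying set and `L` the (reflexive) order relation, as a set of pairs. -/

/-- `x < y`. -/
def Less (L x y : Model.{u}) : Prop := Rel L x y ∧ x ≠ y

/-- `f` is an endomorphism of `(X, L)`: a map `X → X` with `x ≤ y → f(x) ≤ f(y)`. -/
def IsEndomorphism (X L f : Model.{u}) : Prop :=
  IsFunction f X X ∧
  ∀ x y x' y' : Model.{u}, Rel L x y → Rel f x x' → Rel f y y' → Rel L x' y'

/-- `f` is an embedding of `(X, L)` into itself: an injective endomorphism. -/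
def IsEmbedding (X L f : Model.{u}) : Prop := IsEndomorphism X L f ∧ IsInjective f

/-- `f` is an epimorphism of `(X, L)`: a surjective endomorphism. -/
def IsEpimorphism (X L f : Model.{u}) : Prop := IsEndomorphism X L f ∧ IsSurjective f X

/-- `f` is the identity function of `X`. -/
def IsIdentity (X f : Model.{u}) : Prop :=
  IsFunction f X X ∧ ∀ x : Model.{u}, x ∈ X → Rel f x x

/-- The only embedding of `(X, L)` into itself is the identity. -/
def EmbeddingRigid (X L : Model.{u}) : Prop :=
  ∀ f : Model.{u}, IsEmbedding X L f ↔ IsIdentity X f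

/-- The only epimorphism of `(X, L)` is the identity. -/
def EpimorphismRigid (X L : Model.{u}) : Prop :=
  ∀ f : Model.{u}, IsEpimorphism X L f ↔ IsIdentity X f

/-- `f` is constant on the closed interval `[a, b]` of `(X, L)`. -/
def ConstantOnIcc (X L f a b : Model.{u}) : Prop :=
  ∃ c : Model.{u}, ∀ z : Model.{u}, z ∈ X → Rel L a z → Rel L z b → Rel f z c

/-- `x ∈ C_f`: there are `a < x < b` such that `f` is constant on `[a, x]` or on `[x, b]`. -/
def InC (X L f x : Model.{u}) : Prop :=
  x ∈ X ∧ ∃ a b : Model.{u}, a ∈ X ∧ b ∈ X ∧ Less L a x ∧ Less L x b ∧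
    (ConstantOnIcc X L f a x ∨ ConstantOnIcc X L f x b)

/-- `x ∈ I_f`: `f(x) = x`. -/
def InI (X f x : Model.{u}) : Prop := x ∈ X ∧ Rel f x x

/-- `f` is locally identity-constant: `C_f ∪ I_f` is dense in the chain. -/
def LocallyIdentityConstant (X L f : Model.{u}) : Prop :=
  ∀ a b : Model.{u}, a ∈ X → b ∈ X → Less L a b →
    ∃ x : Model.{u}, Less L a x ∧ Less L x b ∧ (InC X L f x ∨ InI X f x)

/-- `J` is a non-trivial interval (a convex subset of the chain with at least two points) on which
`f` is constant. -/
def IsIntervalOfConstancy (X L f J : Model.{u}) : Prop :=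
  (∀ x : Model.{u}, x ∈ J → x ∈ X) ∧
  (∀ x y z : Model.{u}, x ∈ J → z ∈ J → y ∈ X → Rel L x y → Rel L y z → y ∈ J) ∧
  (∃ x y : Model.{u}, x ∈ J ∧ y ∈ J ∧ x ≠ y) ∧
  ∃ c : Model.{u}, ∀ x : Model.{u}, x ∈ J → Rel f x c

/-- `J` is a maximal non-trivial interval on which `f` is constant. -/
def IsMaximalIntervalOfConstancy (X L f J : Model.{u}) : Prop :=
  IsIntervalOfConstancy X L f J ∧
  ∀ K : Model.{u}, IsIntervalOfConstancy X L f K →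
    (∀ x : Model.{u}, x ∈ J → x ∈ K) → K = J

/-- `f` has just finitely many intervals of constancy: the maximal non-trivial intervals on which
`f` is constant form a finite set, and every non-trivial interval on which `f` is constant lies
in one of them. -/
def FinitelyManyIntervalsOfConstancy (X L f : Model.{u}) : Prop :=
  ∃ S : Model.{u}, IsFinite S ∧
    (∀ J : Model.{u}, J ∈ S ↔ IsMaximalIntervalOfConstancy X L f J) ∧
    ∀ K : Model.{u}, IsIntervalOfConstancy X L f K →
      ∃ J : Model.{u}, J ∈ S ∧ ∀ x : Model.{u}, x ∈ K → x ∈ J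

end Model

end Mostowski

/-! A function `f : U → U` in the model is symmetric, so the map `F : ℚ → ℚ` it induces commutes
with every order automorphism fixing some finite set `A` pointwise. Such automorphisms are
plentiful: a point of an open interval can be moved to any other point of it by an automorphism that
is the identity outside. Two facts follow. Each `F x` is `x` or lies in `A` (`apply_eq_or_mem`), and
if `F x ∈ A`, then `F` is constant on every `A`-free open interval around `x` (`eq_of_mem_Ioo`).

So every point off `A` is fixed or has a neighbourhood of constancy, and such points are dense. If
`F` is injective or surjective, all points off `A` are fixed, and monotonicity extends this to `A`.
A monotone `F` can take a value twice only if that value is in `A` (`mem_of_apply_eq`), so its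
non-trivial fibres, which are the maximal intervals of constancy, are finitely many.

The remaining work is absoluteness: pairs, functions and finiteness in the sense of the model are
matched with their external counterparts. -/

namespace Mostowski

/-! ### Order automorphisms of the rationals -/

/-- The piecewise linear map that is the identity outside `(l, r)` and sends `x` to `z`. -/
def bump (l r x z t : ℚ) : ℚ :=
  if t ≤ l then t else if t ≤ x then l + (t - l) * ((z - l) / (x - l))
  else if t < r then r - (r - t) * ((r - z) / (r - x)) else t

theorem bump_of_le_left {l r x z t : ℚ} (h : t ≤ l) : bump l r x z t = t := if_pos h

theorem bump_of_mem_left {l r x z t : ℚ} (h : l < t) (h' : t ≤ x) :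
    bump l r x z t = l + (t - l) * ((z - l) / (x - l)) := by
  rw [bump, if_neg h.not_ge, if_pos h']

theorem bump_of_mem_right {l r x z t : ℚ} (hl : l < x) (h : x < t) (h' : t < r) :
    bump l r x z t = r - (r - t) * ((r - z) / (r - x)) := by
  rw [bump, if_neg (hl.trans h).not_ge, if_neg h.not_ge, if_pos h']

theorem bump_of_right_le {l r x z t : ℚ} (hl : l < x) (hr : x < r) (h : r ≤ t) :
    bump l r x z t = t := by
  rw [bump, if_neg (by linarith), if_neg (by linarith), if_neg h.not_gt]

/-- Exchanging `x` and `z` inverts both slopes, and the inner map carries the two pieces cut at `z`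
to those cut at `x`. -/
theorem bump_bump {l r x z : ℚ} (hx : x ∈ Set.Ioo l r) (hz : z ∈ Set.Ioo l r) (t : ℚ) :
    bump l r x z (bump l r z x t) = t := by
  obtain ⟨hlx, hxr⟩ := hx
  obtain ⟨hlz, hzr⟩ := hz
  have h1 : 0 < x - l := sub_pos.2 hlx
  have h2 : 0 < z - l := sub_pos.2 hlz
  have h3 : 0 < r - x := sub_pos.2 hxr
  have h4 : 0 < r - z := sub_pos.2 hzr
  rcases le_or_gt t l with h | h
  · rw [bump_of_le_left h, bump_of_le_left h]
  rcases le_or_gt t z with h' | h'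
  · rw [bump_of_mem_left h h', bump_of_mem_left]
    · field_simp
      ring
    · have : 0 < (t - l) * ((x - l) / (z - l)) := mul_pos (sub_pos.2 h) (div_pos h1 h2)
      linarith
    · have : (t - l) * ((x - l) / (z - l)) ≤ x - l := by
        rw [← mul_div_assoc, div_le_iff₀ h2, mul_comm]
        exact mul_le_mul_of_nonneg_left (by linarith) h1.le
      linarith
  rcases lt_or_ge t r with h'' | h''
  · rw [bump_of_mem_right hlz h' h'', bump_of_mem_right hlx]
    · field_simp
      ring
    · have : (r - t) * ((r - x) / (r - z)) < r - x := by
        rw [← mul_div_assoc, div_lt_iff₀ h4, mul_comm]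
        exact mul_lt_mul_of_pos_left (by linarith) h3
      linarith
    · have : 0 < (r - t) * ((r - x) / (r - z)) := mul_pos (sub_pos.2 h'') (div_pos h3 h4)
      linarith
  · rw [bump_of_right_le hlz hzr h'', bump_of_right_le hlx hxr h'']

theorem bump_monotone {l r x z : ℚ} (hx : x ∈ Set.Ioo l r) (hz : z ∈ Set.Ioo l r) :
    Monotone (bump l r x z) := by
  obtain ⟨hlx, hxr⟩ := hx
  obtain ⟨hlz, hzr⟩ := hz
  have h1 : 0 < x - l := sub_pos.2 hlx
  have h2 : 0 < z - l := sub_pos.2 hlz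
  have h3 : 0 < r - x := sub_pos.2 hxr
  have h4 : 0 < r - z := sub_pos.2 hzr
  have k1 : 0 < (z - l) / (x - l) := div_pos h2 h1
  have k2 : 0 < (r - z) / (r - x) := div_pos h4 h3
  -- Both linear pieces take the value `z` at `x`; this settles the cases where `s` and `t` lie in
  -- different pieces.
  have e1 : (x - l) * ((z - l) / (x - l)) = z - l := mul_div_cancel₀ _ h1.ne'
  have e2 : (r - x) * ((r - z) / (r - x)) = r - z := mul_div_cancel₀ _ h3.ne'
  intro s t hst
  unfold bump
  split_ifs <;> nlinarith

/-- The source of all automorphisms used below: if `(l, r)` misses a finite set, the automorphism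
fixes that set. -/
theorem exists_orderIso_apply_eq {l r x z : ℚ} (hx : x ∈ Set.Ioo l r) (hz : z ∈ Set.Ioo l r) :
    ∃ g : ℚ ≃o ℚ, g x = z ∧ ∀ t, t ∉ Set.Ioo l r → g t = t := by
  have hmono : StrictMono (bump l r x z) :=
    (bump_monotone hx hz).strictMono_of_injective
      (Function.LeftInverse.injective (bump_bump hz hx))
  refine ⟨hmono.orderIsoOfRightInverse _ (bump l r z x) (bump_bump hx hz), ?_, fun t ht => ?_⟩
  · change bump l r x z x = z
    rw [bump_of_mem_left hx.1 le_rfl, mul_div_cancel₀ _ (sub_pos.2 hx.1).ne']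
    ring
  · change bump l r x z t = t
    rcases le_or_gt t l with h | h
    · exact bump_of_le_left h
    · exact bump_of_right_le hx.1 hx.2 (not_lt.1 fun h' => ht ⟨h, h'⟩)

theorem exists_Ioo_disjoint {A : Finset ℚ} {x : ℚ} (hx : x ∉ A) :
    ∃ l r, x ∈ Set.Ioo l r ∧ ∀ a ∈ A, a ∉ Set.Ioo l r := by
  obtain ⟨l, r, hx', h⟩ := mem_nhds_iff_exists_Ioo_subset.1
    (A.finite_toSet.isClosed.isOpen_compl.mem_nhds (show x ∈ (A : Set ℚ)ᶜ from hx))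
  exact ⟨l, r, hx', fun a ha ha' => h ha' ha⟩

theorem exists_mem_Ioo_notMem (A : Finset ℚ) {a b : ℚ} (h : a < b) :
    ∃ x ∈ Set.Ioo a b, x ∉ A :=
  (Set.Ioo_infinite h).exists_notMem_finset A

/-! ### Maps of the rationals commuting with the automorphisms that fix a finite set -/

/-- `F` commutes with all order automorphisms that fix `A` pointwise. -/
def SupportedBy (A : Finset ℚ) (F : ℚ → ℚ) : Prop :=
  ∀ g : ℚ ≃o ℚ, (∀ a ∈ A, g a = a) → ∀ q, F (g q) = g (F q)

namespace SupportedBy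

variable {A : Finset ℚ} {F : ℚ → ℚ}

/-- Otherwise some open interval around `F x` misses `A` and `x`. An automorphism moving `F x`
inside it fixes `A` and `x`, hence must fix `F x` as well. -/
theorem apply_eq_or_mem (hF : SupportedBy A F) (x : ℚ) : F x = x ∨ F x ∈ A := by
  by_contra! h
  obtain ⟨l, r, hx, hA⟩ := exists_Ioo_disjoint (A := insert x A) (x := F x)
    (by simpa using h)
  obtain ⟨z, hlz, hzx⟩ := exists_between hx.1
  obtain ⟨g, hg, hfix⟩ := exists_orderIso_apply_eq hx (z := z) ⟨hlz, hzx.trans hx.2⟩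
  have h1 := hF g (fun a ha => hfix a (hA a (Finset.mem_insert_of_mem ha))) x
  rw [hfix x (hA x (Finset.mem_insert_self _ _)), hg] at h1
  exact hzx.ne h1.symm

/-- The automorphism taking `x` to `z` fixes `A`, and in particular the value `F x`. -/
theorem eq_of_mem_Ioo (hF : SupportedBy A F) {l r x z : ℚ} (hx : x ∈ Set.Ioo l r)
    (hz : z ∈ Set.Ioo l r) (hA : ∀ a ∈ A, a ∉ Set.Ioo l r) (h : F x ∈ A) : F z = F x := by
  obtain ⟨g, hg, hfix⟩ := exists_orderIso_apply_eq hx hz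
  rw [← hg, hF g (fun a ha => hfix a (hA a ha)), hfix _ (hA _ h)]

/-- The complement of `A` is dense: a fixed point strictly between `x` and `F x` would violate
monotonicity. -/
theorem eq_self_of_eqOn_compl (hmono : Monotone F) (h : ∀ x, x ∉ A → F x = x) (x : ℚ) :
    F x = x := by
  apply le_antisymm <;> apply le_of_not_gt <;> intro hlt
  · obtain ⟨y, ⟨h1, h2⟩, hy⟩ := exists_mem_Ioo_notMem A hlt
    have := hmono h1.le
    rw [h y hy] at this
    exact this.not_gt h2
  · obtain ⟨y, ⟨h1, h2⟩, hy⟩ := exists_mem_Ioo_notMem A hlt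
    have := hmono h2.le
    rw [h y hy] at this
    exact this.not_gt h1

theorem eq_self_of_injective (hF : SupportedBy A F) (hmono : Monotone F)
    (hinj : Function.Injective F) (x : ℚ) : F x = x := by
  refine eq_self_of_eqOn_compl (A := A) hmono (fun x hx => ?_) x
  -- A value in `A` would make `F` constant near `x`.
  refine (hF.apply_eq_or_mem x).resolve_right fun h => ?_
  obtain ⟨l, r, hxI, hA⟩ := exists_Ioo_disjoint hx
  obtain ⟨z, hlz, hzx⟩ := exists_between hxI.1
  exact hzx.ne (hinj (hF.eq_of_mem_Ioo hxI ⟨hlz, hzx.trans hxI.2⟩ hA h))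

theorem eq_self_of_surjective (hF : SupportedBy A F) (hmono : Monotone F)
    (hsurj : Function.Surjective F) (x : ℚ) : F x = x := by
  refine eq_self_of_eqOn_compl (A := A) hmono (fun x hx => ?_) x
  -- A point `F y` off `A` forces `F y = y`, so the point is itself fixed.
  obtain ⟨y, rfl⟩ := hsurj x
  rw [(hF.apply_eq_or_mem y).resolve_right hx]
  exact (hF.apply_eq_or_mem y).resolve_right hx

/-- `F` is constantly `c` on `[x, y]`, and this interval contains some `z ≠ c`, which is therefore
not fixed. -/
theorem mem_of_apply_eq (hF : SupportedBy A F) (hmono : Monotone F) {x y c : ℚ} (hxy : x < y)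
    (hx : F x = c) (hy : F y = c) : c ∈ A := by
  obtain ⟨z, ⟨h1, h2⟩, hz⟩ := exists_mem_Ioo_notMem {c} hxy
  have hzc : F z = c := le_antisymm (hy ▸ hmono h2.le) (hx ▸ hmono h1.le)
  have := (hF.apply_eq_or_mem z).resolve_left
    fun h => hz (Finset.mem_singleton.2 (h.symm.trans hzc))
  rwa [hzc] at this

end SupportedBy

/-! ### Sets with atoms -/

namespace ZFA

theorem atom_injective : Function.Injective atom.{u} := fun _ _ h => Quotient.exact h

theorem ext_of_ne_atom {x y : ZFA.{u}} (hx : ∀ q, x ≠ atom q) (hy : ∀ q, y ≠ atom q)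
    (h : ∀ z, z ∈ x ↔ z ∈ y) : x = y := by
  induction x using Quotient.inductionOn with | _ x
  induction y using Quotient.inductionOn with | _ y
  cases x with
  | atom q => exact (hx q rfl).elim
  | mk α A =>
    cases y with
    | atom q => exact (hy q rfl).elim
    | mk β B =>
      refine Quotient.sound ⟨fun a => ?_, fun b => ?_⟩
      · exact (h (mk (A a))).1 ⟨a, Pre.Equiv.refl _⟩
      · obtain ⟨a, ha⟩ := (h (mk (B b))).2 ⟨b, Pre.Equiv.refl _⟩
        exact ⟨a, ha.symm⟩

theorem ofFamily_ne_atom {α : Type u} (A : α → ZFA.{u}) (q : ℚ) : ofFamily A ≠ atom q :=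
  fun h => Quotient.exact h

theorem smul_mem_smul (g : ℚ ≃o ℚ) {x y : ZFA.{u}} (h : x ∈ y) : g • x ∈ g • y := by
  induction x using Quotient.inductionOn with | _ x
  induction y using Quotient.inductionOn with | _ y
  cases y with
  | atom q => exact h.elim
  | mk α A =>
    obtain ⟨a, ha⟩ := h
    exact ⟨a, Pre.act_congr g ha⟩

end ZFA

/-! ### Construction of objects of the model -/

namespace Model

/-- The model is transitive, so comparing elements within the model compares all elements. -/
theorem ext_of_isSet {x y : Model.{u}} (hx : IsSet x) (hy : IsSet y)
    (h : ∀ z : Model.{u}, z ∈ x ↔ z ∈ y) : x = y := by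
  refine Subtype.ext (ZFA.ext_of_ne_atom (fun q hq => hx q (Subtype.ext hq))
    (fun q hq => hy q (Subtype.ext hq)) fun z => ⟨fun hz => ?_, fun hz => ?_⟩)
  · obtain ⟨_, _, hel⟩ := x.2
    exact (h ⟨z, hel z hz⟩).1 hz
  · obtain ⟨_, _, hel⟩ := y.2
    exact (h ⟨z, hel z hz⟩).2 hz

theorem IsSet.of_mem {x z : Model.{u}} (h : z ∈ x) : IsSet x := by
  rintro q rfl
  exact ZFA.not_mem_atom _ _ h

theorem notMem_self (x : Model.{u}) : x ∉ x := by
  obtain ⟨x, hx⟩ := x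
  change x ∉ x
  -- Hereditary symmetry is an inductive predicate, so induction on it is induction along
  -- membership.
  induction hx with
  | intro x _ _ ih => exact fun h => ih x h h

theorem atom_injective : Function.Injective atom.{u} := fun _ _ h =>
  ZFA.atom_injective (congrArg Subtype.val h)

/-- The set `{A a : a ∈ α}`, as an object of the model, if it is symmetric. -/
noncomputable def ofFamily {α : Type u} (A : α → Model.{u})
    (h : Symmetric (ZFA.ofFamily fun a => (A a).1)) : Model.{u} :=
  ⟨ZFA.ofFamily fun a => (A a).1, .intro _ h fun y hy => by
    obtain ⟨a, rfl⟩ := ZFA.mem_ofFamily.1 hy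
    exact (A a).2⟩

theorem mem_ofFamily {α : Type u} {A : α → Model.{u}}
    {h : Symmetric (ZFA.ofFamily fun a => (A a).1)} {x : Model.{u}} :
    x ∈ ofFamily A h ↔ ∃ a, x = A a :=
  ZFA.mem_ofFamily.trans (exists_congr fun _ => Subtype.ext_iff.symm)

theorem isSet_ofFamily {α : Type u} (A : α → Model.{u})
    (h : Symmetric (ZFA.ofFamily fun a => (A a).1)) : IsSet (ofFamily A h) :=
  fun q hq => ZFA.ofFamily_ne_atom _ q (congrArg Subtype.val hq)

theorem symmetric_ofFamily_of_finite {α : Type u} [Finite α] (A : α → Model.{u}) :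
    Symmetric (ZFA.ofFamily fun a => (A a).1) := by
  have := Fintype.ofFinite α
  choose s hs using fun a => (A a).2.symmetric
  refine ⟨Finset.univ.biUnion s, fun g hg => ?_⟩
  rw [MulAction.mem_stabilizer_iff, ZFA.smul_ofFamily]
  congr 1
  funext a
  exact hs a g fun q hq => hg q (Finset.mem_biUnion.2 ⟨a, Finset.mem_univ a, hq⟩)

/-- The finite set `{A a : a ∈ α}`. -/
noncomputable def ofFinite {α : Type u} [Finite α] (A : α → Model.{u}) : Model.{u} :=
  ofFamily A (symmetric_ofFamily_of_finite A)

theorem mem_ofFinite {α : Type u} [Finite α] {A : α → Model.{u}} {x : Model.{u}} :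
    x ∈ ofFinite A ↔ ∃ a, x = A a := mem_ofFamily

theorem isSet_ofFinite {α : Type u} [Finite α] (A : α → Model.{u}) : IsSet (ofFinite A) :=
  isSet_ofFamily _ _

/-! ### Pairs -/

/-- The unordered pair `{x, y}`. -/
noncomputable def pair (x y : Model.{u}) : Model.{u} := ⟨ZFA.pair x.1 y.1, hs_pair x.2 y.2⟩

/-- Kuratowski's ordered pair. -/
noncomputable def opair (x y : Model.{u}) : Model.{u} := pair (pair x x) (pair x y)

theorem mem_pair {x y z : Model.{u}} : z ∈ pair x y ↔ z = x ∨ z = y := by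
  refine ZFA.mem_ofFamily.trans ⟨?_, ?_⟩
  · rintro ⟨⟨_ | _⟩, h⟩
    · exact Or.inr (Subtype.ext h)
    · exact Or.inl (Subtype.ext h)
  · rintro (rfl | rfl)
    · exact ⟨⟨true⟩, rfl⟩
    · exact ⟨⟨false⟩, rfl⟩

theorem isPair_iff {p x y : Model.{u}} : IsPair p x y ↔ p = pair x y := by
  constructor
  · intro h
    refine ext_of_isSet (.of_mem ((h x).2 (Or.inl rfl))) (.of_mem (mem_pair.2 (Or.inl rfl)))
      fun z => (h z).trans mem_pair.symm
  · rintro rfl z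
    exact mem_pair

theorem isOrderedPair_iff {p x y : Model.{u}} : IsOrderedPair p x y ↔ p = opair x y := by
  unfold IsOrderedPair
  simp only [isPair_iff]
  -- With the inner pairs identified, the goal unfolds to the same statement for `pair x x` and
  -- `pair x y`.
  exact isPair_iff

theorem pair_eq_pair_left {x y z : Model.{u}} (h : pair x y = pair x z) : y = z := by
  have h1 : y ∈ pair x z := h ▸ mem_pair.2 (Or.inr rfl)
  have h2 : z ∈ pair x y := h ▸ mem_pair.2 (Or.inr rfl)
  rcases mem_pair.1 h1 with rfl | h1
  · rcases mem_pair.1 h2 with h2 | h2 <;> exact h2.symm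
  · exact h1

theorem opair_injective {x y x' y' : Model.{u}} (h : opair x y = opair x' y') :
    x = x' ∧ y = y' := by
  have hx : x = x' := by
    have h1 : pair x x ∈ opair x' y' := h ▸ mem_pair.2 (Or.inl rfl)
    have h2 : x' ∈ pair x x := by
      rcases mem_pair.1 h1 with h1 | h1 <;> rw [h1] <;> exact mem_pair.2 (Or.inl rfl)
    rcases mem_pair.1 h2 with h2 | h2 <;> exact h2.symm
  subst hx
  exact ⟨rfl, pair_eq_pair_left (pair_eq_pair_left h)⟩

theorem rel_iff {r x y : Model.{u}} : Rel r x y ↔ opair x y ∈ r := by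
  simp only [Rel, isOrderedPair_iff, exists_eq_right]

/-! ### Natural numbers and finite sets -/

/-- The von Neumann natural numbers. -/
noncomputable def nat (n : ℕ) : Model.{u} := ofFinite fun i : ULift.{u} (Fin n) => nat i.down
termination_by n
decreasing_by exact i.down.2

theorem mem_nat {n : ℕ} {x : Model.{u}} : x ∈ nat n ↔ ∃ i < n, x = nat i := by
  rw [nat, mem_ofFinite]
  exact ⟨fun ⟨i, h⟩ => ⟨i.down, i.down.2, h⟩, fun ⟨i, hi, h⟩ => ⟨⟨⟨i, hi⟩⟩, h⟩⟩

theorem isSet_nat (n : ℕ) : IsSet (nat.{u} n) := by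
  rw [nat]
  exact isSet_ofFinite _

theorem nat_injective : Function.Injective nat.{u} := by
  intro m n h
  by_contra hne
  rcases lt_or_gt_of_ne hne with hlt | hlt
  · have hmem : nat m ∈ nat n := mem_nat.2 ⟨m, hlt, rfl⟩
    rw [h] at hmem
    exact notMem_self _ hmem
  · have hmem : nat n ∈ nat m := mem_nat.2 ⟨n, hlt, rfl⟩
    rw [h] at hmem
    exact notMem_self _ hmem

/-- Extensionality identifies the empty set and the successors found in an inductive set with the
objects `nat n`. -/
theorem isNatural_nat (n : ℕ) : IsNatural (nat.{u} n) := by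
  intro I hI
  induction n with
  | zero =>
    obtain ⟨e, he, hset, hempty⟩ := hI.1
    convert he
    refine ext_of_isSet (isSet_nat 0) hset fun z => ⟨fun hz => ?_, fun hz => (hempty z hz).elim⟩
    obtain ⟨i, hi, _⟩ := mem_nat.1 hz
    exact (Nat.not_lt_zero i hi).elim
  | succ n ih =>
    obtain ⟨s, hs, hsucc⟩ := hI.2 _ ih
    convert hs
    refine ext_of_isSet (isSet_nat _) (.of_mem ((hsucc _).2 (Or.inr rfl))) fun z => ?_
    rw [hsucc, mem_nat, mem_nat]
    constructor
    · rintro ⟨i, hi, rfl⟩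
      rcases Nat.lt_succ_iff_lt_or_eq.1 hi with hi | rfl
      · exact Or.inl ⟨i, hi, rfl⟩
      · exact Or.inr rfl
    · rintro (⟨i, hi, rfl⟩ | rfl)
      · exact ⟨i, hi.trans n.lt_succ_self, rfl⟩
      · exact ⟨n, n.lt_succ_self, rfl⟩

/-- The set and its enumeration are both finite families of objects of the model, so the union of
the members' supports is a support; hence external finiteness gives finiteness inside the model. -/
theorem exists_isFinite {T : Set Model.{u}} (hT : T.Finite) :
    ∃ S : Model.{u}, IsFinite S ∧ ∀ J, J ∈ S ↔ J ∈ T := by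
  have := hT.to_subtype
  obtain ⟨n, ⟨e⟩⟩ := Finite.exists_equiv_fin T
  let a : Fin n → Model.{u} := fun i => (e.symm i).1
  have ha : Function.Injective a := Subtype.val_injective.comp e.symm.injective
  let S : Model.{u} := ofFinite fun i : ULift.{u} (Fin n) => a i.down
  let h : Model.{u} := ofFinite fun i : ULift.{u} (Fin n) => opair (nat i.down) (a i.down)
  have hS : ∀ J, J ∈ S ↔ ∃ i, J = a i := fun J => mem_ofFinite.trans ULift.exists
  have hrel : ∀ x y, Rel h x y ↔ ∃ i : Fin n, x = nat i ∧ y = a i := by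
    intro x y
    rw [rel_iff]
    refine mem_ofFinite.trans (ULift.exists.trans (exists_congr fun i => ⟨opair_injective, ?_⟩))
    rintro ⟨rfl, rfl⟩
    rfl
  refine ⟨S, ⟨isSet_ofFinite _, nat n, h, isNatural_nat n, ⟨isSet_ofFinite _, ?_, ?_⟩, ?_, ?_⟩, ?_⟩
  · intro p hp
    obtain ⟨⟨i⟩, rfl⟩ := mem_ofFinite.1 hp
    exact ⟨nat i, a i, mem_nat.2 ⟨i, i.2, rfl⟩, (hS _).2 ⟨i, rfl⟩, isOrderedPair_iff.2 rfl⟩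
  · intro x hx
    obtain ⟨i, hi, rfl⟩ := mem_nat.1 hx
    refine ⟨a ⟨i, hi⟩, (hrel _ _).2 ⟨⟨i, hi⟩, rfl, rfl⟩, fun y hy => ?_⟩
    obtain ⟨j, hj, rfl⟩ := (hrel _ _).1 hy
    exact congrArg a (Fin.ext (nat_injective hj).symm)
  · intro x x' y hx hx'
    obtain ⟨i, rfl, rfl⟩ := (hrel _ _).1 hx
    obtain ⟨j, rfl, hj⟩ := (hrel _ _).1 hx'
    rw [ha hj]
  · intro y hy
    obtain ⟨i, rfl⟩ := (hS y).1 hy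
    exact ⟨nat i, (hrel _ _).2 ⟨i, rfl, rfl⟩⟩
  · intro J
    rw [hS]
    constructor
    · rintro ⟨i, rfl⟩
      exact (e.symm i).2
    · intro hJ
      exact ⟨e ⟨J, hJ⟩, by simp [a]⟩

/-! ### The chain of atoms -/

theorem mem_U {x : Model.{u}} : x ∈ U.{u} ↔ ∃ q : ℚ, x = atom q :=
  ZFA.mem_ofFamily.trans (ULift.exists.trans (exists_congr fun q =>
    (Subtype.ext_iff (a1 := x) (a2 := atom q)).symm))

theorem atom_mem_U (q : ℚ) : atom.{u} q ∈ U.{u} := mem_U.2 ⟨q, rfl⟩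

theorem rel_leU {x y : Model.{u}} :
    Rel leU x y ↔ ∃ p q : ℚ, p ≤ q ∧ x = atom p ∧ y = atom q := by
  rw [rel_iff]
  refine ZFA.mem_ofFamily.trans ⟨?_, ?_⟩
  · rintro ⟨⟨⟨⟨p, q⟩, hpq⟩⟩, h⟩
    obtain ⟨rfl, rfl⟩ := opair_injective (x' := atom p) (y' := atom q) (Subtype.ext h)
    exact ⟨p, q, hpq, rfl, rfl⟩
  · rintro ⟨p, q, hpq, rfl, rfl⟩
    exact ⟨⟨⟨(p, q), hpq⟩⟩, rfl⟩

theorem rel_leU_atom {p q : ℚ} : Rel leU.{u} (atom p) (atom q) ↔ p ≤ q := by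
  rw [rel_leU]
  constructor
  · rintro ⟨p', q', h, hp, hq⟩
    rwa [atom_injective hp, atom_injective hq]
  · exact fun h => ⟨p, q, h, rfl, rfl⟩

theorem less_atom {p q : ℚ} : Less leU.{u} (atom p) (atom q) ↔ p < q := by
  rw [Less, rel_leU_atom, atom_injective.ne_iff, lt_iff_le_and_ne]

/-- `F` is the map of rationals that the function `f` from `U` to `U` induces. -/
def Represents (F : ℚ → ℚ) (f : Model.{u}) : Prop :=
  ∀ x y : Model.{u}, Rel f x y ↔ ∃ q : ℚ, x = atom q ∧ y = atom (F q)

theorem IsFunction.exists_represents {f : Model.{u}} (hf : IsFunction f U U) :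
    ∃ F : ℚ → ℚ, Represents F f := by
  have hU : ∀ {x y}, Rel f x y → x ∈ U.{u} ∧ y ∈ U.{u} := by
    rintro x y ⟨p, hp, hxy⟩
    obtain ⟨x', y', hx', hy', hp'⟩ := hf.2.1 p hp
    obtain ⟨rfl, rfl⟩ := opair_injective
      ((isOrderedPair_iff.1 hxy).symm.trans (isOrderedPair_iff.1 hp'))
    exact ⟨hx', hy'⟩
  have h : ∀ q : ℚ, ∃ r : ℚ, Rel f (atom q) (atom r) := fun q => by
    obtain ⟨y, hy, _⟩ := hf.2.2 _ (atom_mem_U q)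
    obtain ⟨r, rfl⟩ := mem_U.1 (hU hy).2
    exact ⟨r, hy⟩
  choose F hF using h
  refine ⟨F, fun x y => ⟨fun hxy => ?_, ?_⟩⟩
  · obtain ⟨q, rfl⟩ := mem_U.1 (hU hxy).1
    exact ⟨q, rfl, (hf.2.2 _ (atom_mem_U q)).unique hxy (hF q)⟩
  · rintro ⟨q, rfl, rfl⟩
    exact hF q

/-! ### Internal properties of `f` read off from the rational map -/

namespace Represents

variable {F : ℚ → ℚ} {f : Model.{u}}

theorem rel_atom (h : Represents F f) {p q : ℚ} : Rel f (atom p) (atom q) ↔ F p = q := by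
  rw [h]
  constructor
  · rintro ⟨p', hp, hq⟩
    rw [atom_injective hp, atom_injective hq]
  · rintro rfl
    exact ⟨p, rfl, rfl⟩

/-- If `g` fixes a support of `f`, then `g • f = f`, so `(q, F q) ∈ f` yields `(g q, g (F q)) ∈ f`.
-/
theorem exists_supportedBy (h : Represents F f) : ∃ A, SupportedBy A F := by
  obtain ⟨A, hA⟩ := f.2.symmetric
  refine ⟨A, fun g hg q => ?_⟩
  have h1 : ZFA.opair (ZFA.atom q) (ZFA.atom (F q)) ∈ f.1 := rel_iff.1 (h.rel_atom.2 rfl)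
  have h2 := ZFA.smul_mem_smul g h1
  rw [MulAction.mem_stabilizer_iff.1 (hA g hg), ZFA.smul_opair] at h2
  exact h.rel_atom.1 (rel_iff.2 h2)

theorem isIdentity_iff (h : Represents F f) (hf : IsFunction f U U) :
    IsIdentity U f ↔ ∀ q, F q = q :=
  ⟨fun hid q => h.rel_atom.1 (hid.2 _ (atom_mem_U q)), fun hid => ⟨hf, fun x hx => by
    obtain ⟨q, rfl⟩ := mem_U.1 hx
    exact h.rel_atom.2 (hid q)⟩⟩

theorem isEndomorphism_iff (h : Represents F f) (hf : IsFunction f U U) :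
    IsEndomorphism U leU f ↔ Monotone F := by
  constructor
  · intro he p q hpq
    exact rel_leU_atom.1 (he.2 _ _ _ _ (rel_leU_atom.2 hpq) (h.rel_atom.2 rfl)
      (h.rel_atom.2 rfl))
  · intro hm
    refine ⟨hf, fun x y x' y' hxy hx hy => ?_⟩
    obtain ⟨p, rfl, rfl⟩ := (h _ _).1 hx
    obtain ⟨q, rfl, rfl⟩ := (h _ _).1 hy
    exact rel_leU_atom.2 (hm (rel_leU_atom.1 hxy))

theorem isInjective_iff (h : Represents F f) : IsInjective f ↔ Function.Injective F := by
  constructor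
  · intro hi p q hpq
    exact atom_injective (hi _ _ _ (h.rel_atom.2 hpq) (h.rel_atom.2 rfl))
  · intro hi x x' y hx hx'
    obtain ⟨p, rfl, rfl⟩ := (h _ _).1 hx
    obtain ⟨q, rfl, hq⟩ := (h _ _).1 hx'
    rw [hi (atom_injective hq)]

theorem isSurjective_iff (h : Represents F f) : IsSurjective f U ↔ Function.Surjective F := by
  constructor
  · intro hs q
    obtain ⟨x, hx⟩ := hs _ (atom_mem_U q)
    obtain ⟨p, rfl, hp⟩ := (h _ _).1 hx
    exact ⟨p, (atom_injective hp).symm⟩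
  · intro hs y hy
    obtain ⟨q, rfl⟩ := mem_U.1 hy
    obtain ⟨p, rfl⟩ := hs q
    exact ⟨atom p, h.rel_atom.2 rfl⟩

/-! ### Local identity-constancy and intervals of constancy -/

theorem constantOnIcc_atom (h : Represents F f) {a b c : ℚ}
    (hc : ∀ z ∈ Set.Icc a b, F z = c) : ConstantOnIcc U leU f (atom a) (atom b) := by
  refine ⟨atom c, fun z hz haz hzb => ?_⟩
  obtain ⟨z, rfl⟩ := mem_U.1 hz
  exact h.rel_atom.2 (hc z ⟨rel_leU_atom.1 haz, rel_leU_atom.1 hzb⟩)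

theorem locallyIdentityConstant (h : Represents F f) : LocallyIdentityConstant U leU f := by
  obtain ⟨A, hA⟩ := h.exists_supportedBy
  intro a b ha hb hab
  obtain ⟨a, rfl⟩ := mem_U.1 ha
  obtain ⟨b, rfl⟩ := mem_U.1 hb
  obtain ⟨x, ⟨hax, hxb⟩, hx⟩ := exists_mem_Ioo_notMem A (less_atom.1 hab)
  refine ⟨atom x, less_atom.2 hax, less_atom.2 hxb, ?_⟩
  rcases hA.apply_eq_or_mem x with hfix | hmem
  · exact Or.inr ⟨atom_mem_U x, h.rel_atom.2 hfix⟩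
  · obtain ⟨l, r, hxI, hlr⟩ := exists_Ioo_disjoint hx
    obtain ⟨y, hly, hyx⟩ := exists_between hxI.1
    -- Constancy holds on `[y, x]`; `b` only supplies the point above `x` that `InC` requires.
    refine Or.inl ⟨atom_mem_U x, atom y, atom b, atom_mem_U y, atom_mem_U b, less_atom.2 hyx,
      less_atom.2 hxb, Or.inl (h.constantOnIcc_atom (c := F x) fun z hz => ?_)⟩
    exact hA.eq_of_mem_Ioo hxI ⟨hly.trans_le hz.1, hz.2.trans_lt hxI.2⟩ hlr hmem

/-- The fibres of `F` are objects of the model. -/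
theorem exists_fiber (h : Represents F f) (c : ℚ) :
    ∃ J : Model.{u}, ∀ z, z ∈ J ↔ ∃ q, F q = c ∧ z = atom q := by
  obtain ⟨A, hA⟩ := h.exists_supportedBy
  -- An automorphism fixing `A` and `c` preserves the fibre: `F (g q) = g (F q) = g c = c`.
  refine ⟨ofFamily (fun q : ULift.{u} {q : ℚ // F q = c} => atom q.down.1)
    ⟨insert c A, fun g hg => ?_⟩, fun z => mem_ofFamily.trans ?_⟩
  · have hgA : ∀ a ∈ A, g a = a := fun a ha => hg a (Finset.mem_insert_of_mem ha)
    have hgc : g c = c := hg c (Finset.mem_insert_self c A)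
    rw [MulAction.mem_stabilizer_iff, ZFA.smul_ofFamily]
    refine ZFA.ofFamily_congr (fun a => ⟨⟨⟨g a.down.1, ?_⟩⟩, rfl⟩)
      fun b => ⟨⟨⟨g.symm b.down.1, ?_⟩⟩, ?_⟩
    · rw [hA g hgA, a.down.2, hgc]
    · apply g.injective
      rw [← hA g hgA, g.apply_symm_apply, b.down.2, hgc]
    · exact congrArg ZFA.atom (g.apply_symm_apply _)
  · exact ⟨fun ⟨q, hq⟩ => ⟨q.down.1, q.down.2, hq⟩, fun ⟨q, hq, hz⟩ => ⟨⟨⟨q, hq⟩⟩, hz⟩⟩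

theorem exists_of_isIntervalOfConstancy (h : Represents F f) {J : Model.{u}}
    (hJ : IsIntervalOfConstancy U leU f J) :
    ∃ c, (∀ z, z ∈ J → ∃ q, F q = c ∧ z = atom q) ∧ ∃ p q, p < q ∧ F p = c ∧ F q = c := by
  obtain ⟨-, -, ⟨x, y, hx, hy, hxy⟩, c, hc⟩ := hJ
  obtain ⟨p, rfl, rfl⟩ := (h _ _).1 (hc x hx)
  have key : ∀ z, z ∈ J → ∃ q, F q = F p ∧ z = atom q := fun z hz => by
    obtain ⟨q, rfl, hq⟩ := (h _ _).1 (hc z hz)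
    exact ⟨q, (atom_injective hq).symm, rfl⟩
  refine ⟨F p, key, ?_⟩
  obtain ⟨q, hq, rfl⟩ := key y hy
  rcases lt_or_gt_of_ne (fun e => hxy (congrArg atom e) : p ≠ q) with hlt | hlt
  · exact ⟨p, q, hlt, rfl, hq⟩
  · exact ⟨q, p, hlt, hq, rfl⟩

/-- Monotonicity makes the fibre convex. An interval of constancy containing it takes the value `c`
at `p`, hence everywhere, and so lies in the fibre. -/
theorem isMaximalIntervalOfConstancy_fiber (h : Represents F f) (hm : Monotone F) {J : Model.{u}}
    {c : ℚ} (hJ : ∀ z, z ∈ J ↔ ∃ q, F q = c ∧ z = atom q) {p q : ℚ} (hpq : p < q)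
    (hp : F p = c) (hq : F q = c) : IsMaximalIntervalOfConstancy U leU f J := by
  have hpJ : atom p ∈ J := (hJ _).2 ⟨p, hp, rfl⟩
  refine ⟨⟨fun x hx => ?_, fun x y z hx hz _ hxy hyz => ?_,
    ⟨atom p, atom q, hpJ, (hJ _).2 ⟨q, hq, rfl⟩, atom_injective.ne hpq.ne⟩,
    atom c, fun x hx => ?_⟩, fun K hK hJK => ?_⟩
  · obtain ⟨r, -, rfl⟩ := (hJ x).1 hx
    exact atom_mem_U r
  · obtain ⟨s, hs, rfl⟩ := (hJ x).1 hx
    obtain ⟨t, ht, rfl⟩ := (hJ z).1 hz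
    obtain ⟨s', r, hsr, hs', rfl⟩ := rel_leU.1 hxy
    obtain rfl := atom_injective hs'
    have hrt := rel_leU_atom.1 hyz
    exact (hJ _).2 ⟨r, le_antisymm (ht ▸ hm hrt) (hs ▸ hm hsr), rfl⟩
  · obtain ⟨r, hr, rfl⟩ := (hJ x).1 hx
    exact h.rel_atom.2 hr
  · obtain ⟨c', hc', -⟩ := h.exists_of_isIntervalOfConstancy hK
    obtain ⟨p', hp', hpp'⟩ := hc' _ (hJK _ hpJ)
    obtain rfl := atom_injective hpp'
    obtain rfl := hp.symm.trans hp'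
    exact ext_of_isSet (.of_mem (hJK _ hpJ)) (.of_mem hpJ)
      fun z => ⟨fun hz => (hJ z).2 (hc' z hz), hJK z⟩

/-- Every interval of constancy lies in the fibre over a point of `A`, and that fibre is itself
maximal. So the maximal ones are among the fibres over the finite set `A`. -/
theorem finitelyManyIntervalsOfConstancy (h : Represents F f) (hm : Monotone F) :
    FinitelyManyIntervalsOfConstancy U leU f := by
  obtain ⟨A, hA⟩ := h.exists_supportedBy
  choose fiber hfiber using h.exists_fiber
  have key : ∀ K, IsIntervalOfConstancy U leU f K → ∃ c ∈ A,
      IsMaximalIntervalOfConstancy U leU f (fiber c) ∧ ∀ z, z ∈ K → z ∈ fiber c := by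
    intro K hK
    obtain ⟨c, hc, p, q, hpq, hp, hq⟩ := h.exists_of_isIntervalOfConstancy hK
    exact ⟨c, hA.mem_of_apply_eq hm hpq hp hq,
      h.isMaximalIntervalOfConstancy_fiber hm (hfiber c) hpq hp hq,
      fun z hz => (hfiber c z).2 (hc z hz)⟩
  have hfin : {J : Model.{u} | IsMaximalIntervalOfConstancy U leU f J}.Finite := by
    refine (A.finite_toSet.image fiber).subset fun J hJ => ?_
    obtain ⟨c, hcA, hmax, hsub⟩ := key J hJ.1
    exact ⟨c, hcA, hJ.2 _ hmax.1 hsub⟩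
  obtain ⟨S, hS, hmem⟩ := exists_isFinite hfin
  refine ⟨S, hS, hmem, fun K hK => ?_⟩
  obtain ⟨c, -, hmax, hsub⟩ := key K hK
  exact ⟨fiber c, (hmem _).2 hmax, hsub⟩

end Represents

/-! ### Rigidity of the chain of atoms -/

theorem embeddingRigid_U : EmbeddingRigid.{u} U leU := by
  intro f
  constructor
  · rintro ⟨he, hi⟩
    obtain ⟨F, hF⟩ := he.1.exists_represents
    obtain ⟨A, hA⟩ := hF.exists_supportedBy
    exact (hF.isIdentity_iff he.1).2 (hA.eq_self_of_injective
      ((hF.isEndomorphism_iff he.1).1 he) (hF.isInjective_iff.1 hi))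
  · intro hid
    obtain ⟨F, hF⟩ := hid.1.exists_represents
    obtain rfl : F = id := funext ((hF.isIdentity_iff hid.1).1 hid)
    exact ⟨(hF.isEndomorphism_iff hid.1).2 monotone_id,
      hF.isInjective_iff.2 Function.injective_id⟩

theorem epimorphismRigid_U : EpimorphismRigid.{u} U leU := by
  intro f
  constructor
  · rintro ⟨he, hs⟩
    obtain ⟨F, hF⟩ := he.1.exists_represents
    obtain ⟨A, hA⟩ := hF.exists_supportedBy
    exact (hF.isIdentity_iff he.1).2 (hA.eq_self_of_surjective
      ((hF.isEndomorphism_iff he.1).1 he) (hF.isSurjective_iff.1 hs))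
  · intro hid
    obtain ⟨F, hF⟩ := hid.1.exists_represents
    obtain rfl : F = id := funext ((hF.isIdentity_iff hid.1).1 hid)
    exact ⟨(hF.isEndomorphism_iff hid.1).2 monotone_id,
      hF.isSurjective_iff.2 Function.surjective_id⟩

end Model

end Mostowski

theorem theorem4p1 :
    Mostowski.Model.EmbeddingRigid.{u} Mostowski.Model.U Mostowski.Model.leU ∧
    Mostowski.Model.EpimorphismRigid.{u} Mostowski.Model.U Mostowski.Model.leU ∧
    ∀ f : Mostowski.Model.{u},
      Mostowski.Model.IsEndomorphism Mostowski.Model.U Mostowski.Model.leU f →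
        Mostowski.Model.LocallyIdentityConstant Mostowski.Model.U Mostowski.Model.leU f ∧
        Mostowski.Model.FinitelyManyIntervalsOfConstancy
          Mostowski.Model.U Mostowski.Model.leU f := by
  refine ⟨Mostowski.Model.embeddingRigid_U, Mostowski.Model.epimorphismRigid_U, fun f hf => ?_⟩
  obtain ⟨F, hF⟩ := hf.1.exists_represents
  exact ⟨hF.locallyIdentityConstant,
    hF.finitelyManyIntervalsOfConstancy ((hF.isEndomorphism_iff hf.1).1 hf)⟩
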